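/- A GF(2)-grammar consists of an alphabet $\Sigma$, nonterminal symbols $N$, a finite set of rules $A \to X_1 \odot \dots \odot X_\ell$ ($\ell \ge 0$, $A \in N$, $X_i \in \Sigma \cup N$) and an initial symbol $S \in N$, such that in the ordinary context-free grammar with the rules $A \to X_1 \cdots X_\ell$ every string over $\Sigma$ has only finitely many parse trees. It describes the language of all strings that have an odd number of parse trees (with root $S$). Let $a \ne b$ be letters of an alphabet $\Sigma$. For $K \subseteq a^*b^* = \{a^n b^m : n, m \ge 0\}$, let $$\mathrm{Dual}(K) = \sum_{n, m \ge 0,\ a^n b^m \in K} a^n b^m \in \mathbb{F}_2[[a,b]],$$ a formal power series in two commuting variables. Let $\mathcal{A}$ be the set of all $f \in \mathbb{F}_2[[a]]$ that are algebraic, i.e. satisfy $P(f) = 0$ for some nonzero polynomial $P$ with coefficients in $\mathbb{F}_2[a]$, and let $\mathcal{B} \subseteq \mathbb{F}_2[[b]]$ be the analogous set for the variable $b$. Let $R_{a,b}$ be the set of all elements of the field of fractions of $\mathbb{F}_2[[a,b]]$ that can be written as $$\frac{\sum_{i=1}^n A_i B_i}{p}, \qquad n \ge 0,\ A_i \in \mathcal{A},\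 B_i \in \mathcal{B},\ p \in \mathbb{F}_2[a,b],\ p \ne 0.$$ **Theorem.** If a language $K \subseteq a^*b^*$ is described by a GF(2)-grammar over $\Sigma$, then $\mathrm{Dual}(K) \in R_{a,b}$. -/

import Mathlib

namespace GF2

/-- An ordered sequence of complete parse trees of the context-free grammar `G`, whose root labels
spell a given list of symbols. A tree is either a terminal leaf, or a node labelled by the left-hand
side of a rule, with a sequence of children whose root labels spell the right-hand side. -/
inductive ParseForest {T : Type*} (G : ContextFreeGrammar T) : List (Symbol T G.NT) → Type _
  | nil : ParseForest G []
  | terminal (t : T) {s : List (Symbol T G.NT)} (rest : ParseForest G s) :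
      ParseForest G (Symbol.terminal t :: s)
  | node (r : ContextFreeRule T G.NT) (hr : r ∈ G.rules) (children : ParseForest G r.output)
      {s : List (Symbol T G.NT)} (rest : ParseForest G s) :
      ParseForest G (Symbol.nonterminal r.input :: s)

/-- The string spelled by the leaves, from left to right. -/
def ParseForest.yield {T : Type*} {G : ContextFreeGrammar T} :
    {s : List (Symbol T G.NT)} → ParseForest G s → List T
  | _, .nil => []
  | _, .terminal t rest => t :: rest.yield
  | _, .node _ _ children rest => children.yield ++ rest.yield

/-- The parse trees with root label `A` of the string `w`. -/
def parseTrees {T : Type*} (G : ContextFreeGrammar T) (A : G.NT) (w : List T) :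
    Set (ParseForest G [Symbol.nonterminal A]) :=
  {t | t.yield = w}

/-- A GF(2)-grammar is given by its underlying ordinary grammar `G`; it is well-formed if every
string has finitely many parse trees (rooted at the initial symbol). -/
def WellFormed {T : Type*} (G : ContextFreeGrammar T) : Prop :=
  ∀ w : List T, (parseTrees G G.initial w).Finite

/-- The strings that have an odd number of parse trees with root label `A`. -/
def languageOf {T : Type*} (G : ContextFreeGrammar T) (A : G.NT) : Language T :=
  {w | Odd (parseTrees G A w).ncard}

/-- `K` is described by some (well-formed) GF(2)-grammar. -/
def IsDescribed {T : Type*} (K : Language T) : Prop :=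
  ∃ G : ContextFreeGrammar T, WellFormed G ∧ languageOf G G.initial = K

/-- The language `a^* b^*`. -/
def aStarBStar {T : Type*} (a b : T) : Language T :=
  {w | ∃ n m : ℕ, w = List.replicate n a ++ List.replicate m b}

/-- The power series `∑ a^n b^m` over all `(n, m)` such that the string `a^n b^m` is in `K`. In
`𝔽₂⟦a, b⟧`, the variable number `0` is `a` and the variable number `1` is `b`. -/
noncomputable def dual {T : Type*} (a b : T) (K : Language T) : MvPowerSeries (Fin 2) (ZMod 2) :=
  open scoped Classical in
  fun e => if List.replicate (e 0) a ++ List.replicate (e 1) b ∈ K then 1 else 0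

/-- The univariate series `f(t)`, read as a series in the variable number `i` of `𝔽₂⟦a, b⟧`. -/
noncomputable def inVar (i : Fin 2) (f : PowerSeries (ZMod 2)) : MvPowerSeries (Fin 2) (ZMod 2) :=
  MvPowerSeries.rename (fun _ : Unit => i) f

/-- The algebraic power series in the variable number `i`: those `f` with `P(f) = 0` for some
nonzero polynomial `P` with coefficients in the polynomial ring in that variable. For `i = 0` this
is the set `𝒜`, and for `i = 1` the set `ℬ`. -/
def algSeries (i : Fin 2) : Set (MvPowerSeries (Fin 2) (ZMod 2)) :=
  {g | ∃ f : PowerSeries (ZMod 2), IsAlgebraic (Polynomial (ZMod 2)) f ∧ g = inVar i f}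

/-- Laurent series: fractions of power series in `a` and `b`. -/
abbrev Laurent : Type := FractionRing (MvPowerSeries (Fin 2) (ZMod 2))

/-- The Laurent series of the form `(A₁ B₁ + ⋯ + Aₙ Bₙ) / p` with `n ≥ 0`, `Aᵢ ∈ 𝒜`, `Bᵢ ∈ ℬ` and
`p` a nonzero polynomial in `a` and `b`. -/
def Rab : Set Laurent :=
  {f | ∃ (n : ℕ) (A B : Fin n → MvPowerSeries (Fin 2) (ZMod 2)) (p : MvPolynomial (Fin 2) (ZMod 2)),
    (∀ i, A i ∈ algSeries 0) ∧ (∀ i, B i ∈ algSeries 1) ∧ p ≠ 0 ∧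
    f = algebraMap (MvPowerSeries (Fin 2) (ZMod 2)) Laurent (∑ i, A i * B i) /
        algebraMap (MvPowerSeries (Fin 2) (ZMod 2)) Laurent (p : MvPowerSeries (Fin 2) (ZMod 2))}

end GF2

/-! Count parse trees modulo 2. When a rule `A → X₁ ⋯ X_ℓ` derives `a^n b^m`, the first letter `b`,
if there is one, falls inside a single `X_i`; the symbols to its left yield powers of `a`, those to
its right powers of `b`. Hence the bivariate series of the nonterminals satisfy a system that is
linear, although the grammar is not: the coefficients are sums of products of univariate series in
`a` (left context) and in `b` (right context). This is `biSeries_cons`, unrolled in `biSeries_eq`.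

The univariate series are algebraic. They solve the polynomial system of the grammar, and a solution
with nonzero Jacobian determinant is algebraic (`isAlgebraic_of_det_pderiv_ne_zero`).

The Jacobian and the matrix of the linear system both have the form `1 - systemMatrix`, and their
constant terms agree: they count how a nonterminal derives another one with only empty strings
around it. A cycle of such derivations would give some string infinitely many parse trees, so this
matrix of constant terms is unitriangular in a suitable order and both determinants are nonzero
(`det_one_sub_systemMatrix_ne_zero`).

Cramer's rule now writes the series as a quotient of elements of the ring `sumProd` generated by `𝒜`
and `ℬ`. The denominator is algebraic over `𝔽₂[a, b]`, so it divides a nonzero polynomial inside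
this ring (`exists_mul_eq_coe`). Finiteness is only known for trees below the initial symbol, so
everything is restricted to nonterminals that occur in complete parse trees. -/

namespace GF2

variable {T : Type*} {G : ContextFreeGrammar T}

/-! ### Decomposition of parse trees and forests -/

namespace ParseForest

/-- Juxtaposition of two forests. -/
def append : {s s' : List (Symbol T G.NT)} → ParseForest G s → ParseForest G s' →
    ParseForest G (s ++ s')
  | _, _, .nil, q => q
  | _, _, .terminal t rest, q => .terminal t (rest.append q)
  | _, _, .node r hr children rest, q => .node r hr children (rest.append q)

/-- The number of terminals and internal nodes. -/
def size : {s : List (Symbol T G.NT)} → ParseForest G s → ℕ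
  | _, .nil => 0
  | _, .terminal _ rest => rest.size + 1
  | _, .node _ _ children rest => children.size + rest.size + 1

theorem yield_append {s s' : List (Symbol T G.NT)} (p : ParseForest G s) (q : ParseForest G s') :
    (p.append q).yield = p.yield ++ q.yield := by
  induction p with
  | nil => simp [append, yield]
  | terminal t rest ih => simp [append, yield, ih]
  | node r hr c rest _ ih => simp [append, yield, ih]

theorem size_append {s s' : List (Symbol T G.NT)} (p : ParseForest G s) (q : ParseForest G s') :
    (p.append q).size = p.size + q.size := by
  induction p with
  | nil => simp [append, size]
  | terminal t rest ih => simp only [append, size, ih]; omega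
  | node r hr c rest _ ih => simp only [append, size, ih]; omega

/-- The first tree of a nonempty forest. -/
def head {X : Symbol T G.NT} {s : List (Symbol T G.NT)} :
    ParseForest G (X :: s) → ParseForest G [X]
  | .terminal t _ => .terminal t .nil
  | .node r hr children _ => .node r hr children .nil

/-- The forest without its first tree. -/
def tail {X : Symbol T G.NT} {s : List (Symbol T G.NT)} :
    ParseForest G (X :: s) → ParseForest G s
  | .terminal _ rest => rest
  | .node _ _ _ rest => rest

/-- A nonempty forest is its first tree followed by the other trees. -/
def consEquiv (X : Symbol T G.NT) (s : List (Symbol T G.NT)) :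
    ParseForest G (X :: s) ≃ ParseForest G [X] × ParseForest G s where
  toFun p := (p.head, p.tail)
  invFun p := p.1.append p.2
  left_inv p := by cases p <;> rfl
  right_inv := by
    rintro ⟨p, q⟩
    cases p with
    | terminal t rest => cases rest; rfl
    | node r hr c rest => cases rest; rfl

theorem yield_consEquiv_symm {X : Symbol T G.NT} {s : List (Symbol T G.NT)}
    (p : ParseForest G [X] × ParseForest G s) :
    ((consEquiv X s).symm p).yield = p.1.yield ++ p.2.yield :=
  yield_append _ _

theorem size_consEquiv_symm {X : Symbol T G.NT} {s : List (Symbol T G.NT)}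
    (p : ParseForest G [X] × ParseForest G s) :
    ((consEquiv X s).symm p).size = p.1.size + p.2.size :=
  size_append _ _

theorem yield_eq_head_append_tail {X : Symbol T G.NT} {s : List (Symbol T G.NT)}
    (p : ParseForest G (X :: s)) : p.yield = p.head.yield ++ p.tail.yield := by
  rw [← yield_append]
  exact congrArg yield ((consEquiv X s).left_inv p).symm

/-- A tree is the choice of a rule and a forest for the right-hand side of this rule. -/
def nodeEquiv (A : G.NT) : ParseForest G [Symbol.nonterminal A] ≃
    Σ r : {r : ContextFreeRule T G.NT // r ∈ G.rules ∧ r.input = A}, ParseForest G r.1.output where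
  toFun
    | .node r hr children _ => ⟨⟨r, hr, rfl⟩, children⟩
  invFun
    | ⟨⟨r, hr, h⟩, c⟩ => h ▸ .node r hr c .nil
  left_inv p := by
    cases p with
    | node r hr c rest => cases rest; rfl
  right_inv := by
    rintro ⟨⟨r, hr, rfl⟩, c⟩
    rfl

theorem yield_nodeEquiv_symm {A : G.NT}
    (p : Σ r : {r : ContextFreeRule T G.NT // r ∈ G.rules ∧ r.input = A},
      ParseForest G r.1.output) :
    ((nodeEquiv A).symm p).yield = p.2.yield := by
  obtain ⟨⟨r, hr, rfl⟩, c⟩ := p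
  exact List.append_nil _

theorem eq_terminal {t : T}
    (p : ParseForest G [Symbol.terminal t]) : p = .terminal t .nil := by
  cases p with
  | terminal t rest => cases rest; rfl

/-- The forests with a given yield. -/
abbrev OfYield (G : ContextFreeGrammar T) (s : List (Symbol T G.NT)) (w : List T) : Type _ :=
  {p : ParseForest G s // p.yield = w}

/-- A forest with yield `w` is given by a splitting of `w`, a tree and a forest. -/
def ofYieldConsEquiv (X : Symbol T G.NT) (s : List (Symbol T G.NT)) (w : List T) :
    OfYield G (X :: s) w ≃
      Σ k : Fin (w.length + 1), OfYield G [X] (w.take k) × OfYield G s (w.drop k) where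
  toFun p := ⟨⟨p.1.head.yield.length, by
      have h := congrArg List.length (p.1.yield_eq_head_append_tail.symm.trans p.2)
      rw [List.length_append] at h
      omega⟩,
    ⟨p.1.head, by simp [← p.2, p.1.yield_eq_head_append_tail]⟩,
    ⟨p.1.tail, by simp [← p.2, p.1.yield_eq_head_append_tail]⟩⟩
  invFun q := ⟨(consEquiv X s).symm (q.2.1.1, q.2.2.1), by
    simp [yield_consEquiv_symm, q.2.1.2, q.2.2.2]⟩
  left_inv p := Subtype.ext ((consEquiv X s).left_inv p.1)
  right_inv := by
    rintro ⟨⟨k, hk⟩, ⟨p, hp⟩, ⟨q, hq⟩⟩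
    have h := (consEquiv X s).right_inv (p, q)
    have h1 : ((consEquiv X s).symm (p, q)).head = p := congrArg Prod.fst h
    have h2 : ((consEquiv X s).symm (p, q)).tail = q := congrArg Prod.snd h
    have hk' : p.yield.length = k := by
      rw [hp, List.length_take]
      exact min_eq_left (Nat.le_of_lt_succ hk)
    subst hk'
    -- The index `k` and the types of both components depend on the head and the tail, so these are
    -- generalized before being replaced by `p` and `q`.
    have key : ∀ (p' : ParseForest G [X]) (q' : ParseForest G s), p' = p → q' = q →
        ∀ (hl : p'.yield.length < w.length + 1) (hp' : p'.yield = w.take p'.yield.length)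
          (hq' : q'.yield = w.drop p'.yield.length),
        (⟨⟨p'.yield.length, hl⟩, ⟨p', hp'⟩, ⟨q', hq'⟩⟩ :
          Σ k : Fin (w.length + 1), OfYield G [X] (w.take k) × OfYield G s (w.drop k)) =
        ⟨⟨p.yield.length, hk⟩, ⟨p, hp⟩, ⟨q, hq⟩⟩ := by
      rintro _ _ rfl rfl _ _ _
      rfl
    exact key _ _ h1 h2 _ _ _

/-- A tree with yield `w` is given by a rule and a forest with yield `w`. -/
def ofYieldNodeEquiv (A : G.NT) (w : List T) :
    OfYield G [Symbol.nonterminal A] w ≃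
      Σ r : {r : ContextFreeRule T G.NT // r ∈ G.rules ∧ r.input = A}, OfYield G r.1.output w where
  toFun p := ⟨(nodeEquiv A p.1).1, (nodeEquiv A p.1).2, by
    rw [← yield_nodeEquiv_symm, Equiv.symm_apply_apply, p.2]⟩
  invFun q := ⟨(nodeEquiv A).symm ⟨q.1, q.2.1⟩, by rw [yield_nodeEquiv_symm, q.2.2]⟩
  left_inv p := Subtype.ext ((nodeEquiv A).left_inv p.1)
  right_inv := by
    rintro ⟨⟨r, hr, rfl⟩, c⟩
    rfl

end ParseForest

/-! ### Useful nonterminals and finiteness -/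

open ParseForest

/-- A nonterminal that occurs in some complete parse tree with root label `G.initial`: it has a
parse tree, and its parse trees can be plugged into some context. -/
def Useful (G : ContextFreeGrammar T) (A : G.NT) : Prop :=
  Nonempty (ParseForest G [Symbol.nonterminal A]) ∧
    ∃ (x y : List T)
      (f : ParseForest G [Symbol.nonterminal A] → ParseForest G [Symbol.nonterminal G.initial]),
      Function.Injective f ∧ ∀ t, (f t).yield = x ++ t.yield ++ y

theorem useful_initial (h : Nonempty (ParseForest G [Symbol.nonterminal G.initial])) :
    Useful G G.initial :=
  ⟨h, [], [], id, Function.injective_id, fun t => by simp⟩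

/-- The context of `A` injects the trees of `w` into the trees of `x ++ w ++ y` below the initial
symbol. -/
theorem Useful.finite_ofYield (hG : WellFormed G) {A : G.NT} (hA : Useful G A) (w : List T) :
    Finite (OfYield G [Symbol.nonterminal A] w) := by
  obtain ⟨-, x, y, f, hf, hy⟩ := hA
  have : Finite (parseTrees G G.initial (x ++ w ++ y)) := hG _
  refine Finite.of_injective (β := parseTrees G G.initial (x ++ w ++ y))
    (fun p => ⟨f p.1, by simp [parseTrees, hy, p.2]⟩) fun p q h => ?_
  exact Subtype.ext (hf (congrArg Subtype.val h))

/-- All trees of `p` are kept except the one at the first occurrence of `B`, which is left free. -/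
theorem exists_context_of_mem {B : G.NT} {s : List (Symbol T G.NT)} (p : ParseForest G s)
    (hB : Symbol.nonterminal B ∈ s) :
    Nonempty (ParseForest G [Symbol.nonterminal B]) ∧
      ∃ (x y : List T) (f : ParseForest G [Symbol.nonterminal B] → ParseForest G s),
        Function.Injective f ∧ ∀ t, (f t).yield = x ++ t.yield ++ y := by
  induction s with
  | nil => simp at hB
  | cons X s ih =>
    by_cases h : Symbol.nonterminal B = X
    · subst h
      refine ⟨⟨p.head⟩, [], p.tail.yield, fun t => (consEquiv _ s).symm (t, p.tail),
        fun t u h => ?_, fun t => by simp [yield_consEquiv_symm]⟩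
      simpa using h
    · obtain ⟨hn, x, y, f, hf, hy⟩ := ih p.tail (by simpa [h] using hB)
      refine ⟨hn, p.head.yield ++ x, y, fun t => (consEquiv _ s).symm (p.head, f t),
        fun t u h => ?_, fun t => by simp [yield_consEquiv_symm, hy]⟩
      exact hf (by simpa using h)

/-- All nonterminals of the string `s` are useful. -/
def AllUseful (G : ContextFreeGrammar T) (s : List (Symbol T G.NT)) : Prop :=
  ∀ A : G.NT, Symbol.nonterminal A ∈ s → Useful G A

theorem AllUseful.head {X : Symbol T G.NT} {s : List (Symbol T G.NT)}
    (h : AllUseful G (X :: s)) : AllUseful G [X] :=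
  fun A hA => h A (by simp at hA; simp [hA])

theorem AllUseful.tail {X : Symbol T G.NT} {s : List (Symbol T G.NT)}
    (h : AllUseful G (X :: s)) : AllUseful G s :=
  fun A hA => h A (List.mem_cons_of_mem _ hA)

/-- The context of `B` inside the right-hand side, supplied by the siblings in `p`, is composed with
the context of the left-hand side. -/
theorem allUseful_output {r : ContextFreeRule T G.NT} (hr : r ∈ G.rules) (hA : Useful G r.input)
    (p : ParseForest G r.output) : AllUseful G r.output := by
  intro B hB
  obtain ⟨hn, x, y, f, hf, hy⟩ := exists_context_of_mem p hB
  obtain ⟨-, x', y', f', hf', hy'⟩ := hA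
  refine ⟨hn, x' ++ x, y ++ y', fun t => f' (.node r hr (f t) .nil), fun t u h => ?_, fun t => ?_⟩
  · have := hf' h
    simp only [node.injEq, and_true] at this
    exact hf this
  · simp [hy', hy, yield]

theorem finite_ofYield_terminal (t : T) (w : List T) :
    Finite (OfYield G [Symbol.terminal t] w) := by
  have : Subsingleton (OfYield G [Symbol.terminal t] w) :=
    ⟨fun p q => Subtype.ext (by rw [eq_terminal p.1, eq_terminal q.1])⟩
  infer_instance

theorem finite_ofYield_singleton (hG : WellFormed G) {X : Symbol T G.NT} (hX : AllUseful G [X])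
    (w : List T) : Finite (OfYield G [X] w) := by
  cases X with
  | terminal t => exact finite_ofYield_terminal t w
  | nonterminal A => exact (hX A (by simp)).finite_ofYield hG w

theorem finite_ofYield (hG : WellFormed G) {s : List (Symbol T G.NT)} (hs : AllUseful G s)
    (w : List T) : Finite (OfYield G s w) := by
  induction s generalizing w with
  | nil =>
    have : Subsingleton (OfYield G [] w) :=
      ⟨fun ⟨p, _⟩ ⟨q, _⟩ => by cases p; cases q; rfl⟩
    infer_instance
  | cons X s ih =>
    have h1 := finite_ofYield_singleton hG hs.head
    have h2 := ih hs.tail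
    exact Finite.of_equiv _ (ofYieldConsEquiv X s w).symm

/-- The trees with root label `B` can be enlarged to trees with root label `A` and the same
yield. -/
def Enlarges (G : ContextFreeGrammar T) (A B : G.NT) : Prop :=
  ∃ f : ParseForest G [Symbol.nonterminal B] → ParseForest G [Symbol.nonterminal A],
    ∀ t, (f t).yield = t.yield ∧ t.size < (f t).size

theorem Enlarges.trans {A B C : G.NT} (h : Enlarges G A B) (h' : Enlarges G B C) :
    Enlarges G A C := by
  obtain ⟨f, hf⟩ := h
  obtain ⟨g, hg⟩ := h'
  exact ⟨f ∘ g, fun t => ⟨(hf _).1.trans (hg _).1, (hg _).2.trans (hf _).2⟩⟩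

/-- Iterating the enlargement on one tree would produce infinitely many trees with the same yield,
distinguished by their sizes. -/
theorem Useful.not_enlarges_self (hG : WellFormed G) {A : G.NT} (hA : Useful G A) :
    ¬ Enlarges G A A := by
  rintro ⟨f, hf⟩
  obtain ⟨t⟩ := hA.1
  have hy : ∀ n, (f^[n] t).yield = t.yield := by
    intro n
    induction n with
    | zero => rfl
    | succ n ih => rw [Function.iterate_succ_apply', (hf _).1, ih]
  have hm : StrictMono fun n => (f^[n] t).size :=
    strictMono_nat_of_lt_succ fun n => by
      rw [Function.iterate_succ_apply']
      exact (hf _).2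
  have := hA.finite_ofYield hG t.yield
  refine not_injective_infinite_finite
    (fun n => (⟨f^[n] t, hy n⟩ : OfYield G [Symbol.nonterminal A] t.yield)) fun m n h => ?_
  exact hm.injective (congrArg (fun p => p.1.size) h)

/-- The type of nonterminals may be infinite, but a nonterminal with a parse tree is the left-hand
side of one of the finitely many rules. -/
theorem finite_useful (G : ContextFreeGrammar T) : Finite {A : G.NT // Useful G A} := by
  have h : {A : G.NT | Useful G A} ⊆ (ContextFreeRule.input '' (↑G.rules : Set (ContextFreeRule T G.NT))) := by
    rintro A ⟨⟨t⟩, -⟩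
    cases t with
    | node r hr c rest => exact ⟨r, hr, rfl⟩
  exact (G.rules.finite_toSet.image _).subset h

end GF2

/-! ### Algebraicity of nondegenerate solutions of polynomial systems -/

open MvPolynomial in
theorem Derivation.map_mvPolynomial_aeval {R A M ι : Type*} [CommRing R] [CommRing A] [Algebra R A]
    [AddCommGroup M] [Module A M] [Module R M] [IsScalarTower R A M] [Fintype ι]
    (D : Derivation R A M) (α : ι → A) (p : MvPolynomial ι R) :
    D (aeval α p) = ∑ j, aeval α (pderiv j p) • D (α j) := by
  classical
  induction p using MvPolynomial.induction_on with
  | C r => simp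
  | add p q hp hq => simp [hp, hq, add_smul, Finset.sum_add_distrib]
  | mul_X p i hp =>
    simp only [map_mul, aeval_X, Derivation.leibniz, hp, pderiv_X, smul_eq_mul, map_add, add_smul,
      Finset.sum_add_distrib, Finset.smul_sum, mul_smul]
    congr 1
    rw [Finset.sum_eq_single i]
    · simp
    · intro j _ hj
      simp [Pi.single_eq_of_ne' hj]
    · simp

theorem Matrix.eq_zero_of_sum_smul_eq_zero {E M ι : Type*} [Field E] [AddCommGroup M] [Module E M]
    [Fintype ι] [DecidableEq ι] {J : Matrix ι ι E} (hJ : J.det ≠ 0) {d : ι → M}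
    (h : ∀ i, ∑ j, J i j • d j = 0) (k : ι) : d k = 0 := by
  have h1 : J.det • d k = ∑ j, (J.adjugate * J) k j • d j := by
    rw [Matrix.adjugate_mul, Finset.sum_eq_single k]
    · simp
    · intro j _ hj
      simp [Matrix.one_apply_ne' hj]
    · simp
  have h2 : ∑ j, (J.adjugate * J) k j • d j = 0 := by
    simp only [Matrix.mul_apply, Finset.sum_smul, mul_smul]
    rw [Finset.sum_comm]
    simp only [← Finset.smul_sum, h, smul_zero, Finset.sum_const_zero]
  exact (smul_eq_zero.1 (h1.trans h2)).resolve_left hJ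

/-- The constants of an `F`-derivation form a field containing `F`. -/
theorem Derivation.eq_zero_of_adjoin {F K M : Type*} [Field F] [Field K] [Algebra F K] {s : Set K}
    [AddCommGroup M] [Module (IntermediateField.adjoin F s) M] [Module F M]
    (D : Derivation F (IntermediateField.adjoin F s) M)
    (h : ∀ x (hx : x ∈ s), D ⟨x, IntermediateField.subset_adjoin F s hx⟩ = 0) : D = 0 := by
  ext ⟨x, hx⟩
  induction hx using IntermediateField.adjoin_induction with
  | mem x hx => exact h x hx
  | algebraMap x => exact D.map_algebraMap x
  | add x y hx hy h1 h2 =>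
    rw [show (⟨x + y, add_mem hx hy⟩ : IntermediateField.adjoin F s) = ⟨x, hx⟩ + ⟨y, hy⟩ from rfl,
      D.map_add, h1, h2]
    simp
  | inv x hx h1 =>
    rw [show (⟨x⁻¹, inv_mem hx⟩ : IntermediateField.adjoin F s) = (⟨x, hx⟩)⁻¹ from rfl,
      D.leibniz_inv, h1]
    simp
  | mul x y hx hy h1 h2 =>
    rw [show (⟨x * y, mul_mem hx hy⟩ : IntermediateField.adjoin F s) = ⟨x, hx⟩ * ⟨y, hy⟩ from rfl,
      D.leibniz, h1, h2]
    simp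

open MvPolynomial in
/-- A nondegenerate solution of a square polynomial system over a field is algebraic. -/
theorem isAlgebraic_of_det_pderiv_ne_zero_of_field {F K ι : Type*} [Field F] [Field K] [Algebra F K]
    [Fintype ι] [DecidableEq ι] {α : ι → K} {P : ι → MvPolynomial ι F}
    (hP : ∀ i, aeval α (P i) = 0)
    (hJ : (Matrix.of fun i j => aeval α (pderiv j (P i))).det ≠ 0) (i : ι) :
    IsAlgebraic F (α i) := by
  let E := IntermediateField.adjoin F (Set.range α)
  let α' : ι → E := fun i => ⟨α i, IntermediateField.subset_adjoin F _ ⟨i, rfl⟩⟩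
  have hα : ∀ p : MvPolynomial ι F, algebraMap E K (aeval α' p) = aeval α p := fun p => by
    rw [← aeval_algebraMap_apply]
    rfl
  have hP' : ∀ i, aeval α' (P i) = 0 := fun i =>
    (algebraMap E K).injective (by rw [hα, hP, map_zero])
  have hJ' : (Matrix.of fun i j => aeval α' (pderiv j (P i))).det ≠ 0 := fun h => hJ <| by
    have := congrArg (algebraMap E K) h
    rw [RingHom.map_det, map_zero] at this
    rw [← this]
    congr 1
    ext i j
    exact (hα _).symm
  -- Differentiating the equations gives `J · dα = 0` by the chain rule; as `J` is invertible, the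
  -- differentials of the generators of `E` vanish.
  have hD : KaehlerDifferential.D F E = 0 := by
    refine Derivation.eq_zero_of_adjoin _ ?_
    rintro _ ⟨k, rfl⟩
    refine Matrix.eq_zero_of_sum_smul_eq_zero hJ' (fun i => ?_) k
      (d := fun k => KaehlerDifferential.D F E (α' k))
    have := (KaehlerDifferential.D F E).map_mvPolynomial_aeval α' (P i)
    rw [hP', map_zero] at this
    exact this.symm
  -- Vanishing differentials make the finitely generated extension `E / F` unramified, hence
  -- separable algebraic. This is valid in characteristic 2 as well.
  have hU : Algebra.FormallyUnramified F E := by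
    refine ⟨?_⟩
    rw [← Submodule.subsingleton_iff E, ← subsingleton_iff_bot_eq_top,
      ← KaehlerDifferential.span_range_derivation, hD]
    symm
    rw [Submodule.span_eq_bot]
    rintro _ ⟨x, rfl⟩
    rfl
  have hF : Algebra.EssFiniteType F E :=
    IntermediateField.essFiniteType_iff.2 (IntermediateField.fg_adjoin_of_finite (Set.finite_range α))
  have hS := (Algebra.FormallyUnramified.iff_isSeparable F E).1 hU
  exact (isAlgebraic_algebraMap_iff (algebraMap E K).injective).2
    (Algebra.IsSeparable.isAlgebraic F E |>.isAlgebraic (α' i))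

open MvPolynomial in
/-- A nondegenerate solution of a square polynomial system over a domain is algebraic. -/
theorem isAlgebraic_of_det_pderiv_ne_zero {R S ι : Type*} [CommRing R] [IsDomain R] [CommRing S]
    [IsDomain S] [Algebra R S] [FaithfulSMul R S]
    [Fintype ι] [DecidableEq ι] {α : ι → S} {P : ι → MvPolynomial ι R}
    (hP : ∀ i, aeval α (P i) = 0)
    (hJ : (Matrix.of fun i j => aeval α (pderiv j (P i))).det ≠ 0) (i : ι) :
    IsAlgebraic R (α i) := by
  let F := FractionRing R
  let K := FractionRing S
  have : FaithfulSMul R K := .trans R S K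
  let _ : Algebra F K := FractionRing.liftAlgebra R K
  have : IsScalarTower R F K := FractionRing.isScalarTower_liftAlgebra R K
  have key : ∀ p : MvPolynomial ι R, aeval (fun i => algebraMap S K (α i))
      (MvPolynomial.map (algebraMap R F) p) = algebraMap S K (aeval α p) := fun p => by
    rw [MvPolynomial.aeval_map_algebraMap]
    exact aeval_algebraMap_apply _ _ _
  have hinj : Function.Injective (algebraMap S K) := IsFractionRing.injective S K
  rw [← isAlgebraic_algebraMap_iff hinj (R := R), IsFractionRing.isAlgebraic_iff R F K]
  refine isAlgebraic_of_det_pderiv_ne_zero_of_field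
    (α := fun i => algebraMap S K (α i)) (P := fun i => MvPolynomial.map (algebraMap R F) (P i))
    (fun i => by rw [key, hP, map_zero]) (fun h => hJ (hinj ?_)) i
  rw [RingHom.map_det, map_zero, ← h]
  congr 1
  ext i j
  simp only [RingHom.mapMatrix_apply, Matrix.map_apply, Matrix.of_apply]
  rw [MvPolynomial.pderiv_map, key]

/-! ### Generating series of parse tree parities -/

namespace GF2

open ParseForest

variable {T : Type*} {G : ContextFreeGrammar T}

/-- The parity of the number of forests with yield `w` and root labels `s`. -/
noncomputable def count (G : ContextFreeGrammar T) (s : List (Symbol T G.NT)) (w : List T) :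
    ZMod 2 :=
  (Nat.card (OfYield G s w) : ZMod 2)

theorem nonempty_ofYield_of_count_ne_zero {s : List (Symbol T G.NT)} {w : List T}
    (h : count G s w ≠ 0) : Nonempty (OfYield G s w) := by
  by_contra hn
  rw [not_nonempty_iff] at hn
  exact h (by simp [count])

theorem count_nil (w : List T) [Decidable (w = [])] : count G [] w = if w = [] then 1 else 0 := by
  have hs : Subsingleton (OfYield G [] w) := ⟨fun ⟨p, _⟩ ⟨q, _⟩ => by cases p; cases q; rfl⟩
  split_ifs with h
  · subst h
    have : Unique (OfYield G [] ([] : List T)) := ⟨⟨⟨.nil, rfl⟩⟩, fun _ => Subsingleton.elim _ _⟩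
    simp [count]
  · have : IsEmpty (OfYield G [] w) := ⟨fun ⟨p, hp⟩ => by cases p; exact h hp.symm⟩
    simp [count]

theorem count_terminal (t : T) (w : List T) [Decidable (w = [t])] :
    count G [Symbol.terminal t] w = if w = [t] then 1 else 0 := by
  have hs : Subsingleton (OfYield G [Symbol.terminal t] w) :=
    ⟨fun p q => Subtype.ext (by rw [eq_terminal p.1, eq_terminal q.1])⟩
  split_ifs with h
  · subst h
    have : Unique (OfYield G [Symbol.terminal t] [t]) :=
      ⟨⟨⟨.terminal t .nil, rfl⟩⟩, fun _ => Subsingleton.elim _ _⟩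
    simp [count]
  · have : IsEmpty (OfYield G [Symbol.terminal t] w) :=
      ⟨fun ⟨p, hp⟩ => h (by rw [← hp, eq_terminal p]; rfl)⟩
    simp [count]

/-- `Nat.card` of an infinite type is `0`, so adding up over the splittings requires each fibre to
be finite; usefulness of the symbols provides this. -/
theorem count_cons (hG : WellFormed G) {X : Symbol T G.NT} {s : List (Symbol T G.NT)}
    (hs : AllUseful G (X :: s)) (w : List T) :
    count G (X :: s) w =
      ∑ k ∈ Finset.range (w.length + 1), count G [X] (w.take k) * count G s (w.drop k) := by
  have h1 := finite_ofYield_singleton hG hs.head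
  have h2 := finite_ofYield hG hs.tail
  rw [count, Nat.card_congr (ofYieldConsEquiv X s w), Nat.card_sigma, Finset.sum_range]
  simp [count, Nat.card_prod]

open scoped Classical in
/-- The rules for `A` that have only useful nonterminals on the right-hand side. -/
noncomputable def usefulRules (G : ContextFreeGrammar T) (A : G.NT) :
    Finset (ContextFreeRule T G.NT) :=
  G.rules.filter fun r => r.input = A ∧ AllUseful G r.output

theorem mem_usefulRules {A : G.NT} {r : ContextFreeRule T G.NT} :
    r ∈ usefulRules G A ↔ r ∈ G.rules ∧ r.input = A ∧ AllUseful G r.output := by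
  simp [usefulRules]

/-- A rule outside `usefulRules` contributes no tree: if its right-hand side had a forest, all its
nonterminals would inherit usefulness from `A`. -/
theorem count_nonterminal (hG : WellFormed G) {A : G.NT} (hA : Useful G A) (w : List T) :
    count G [Symbol.nonterminal A] w = ∑ r ∈ usefulRules G A, count G r.output w := by
  classical
  have hempty : ∀ r ∈ G.rules, r.input = A → ¬ AllUseful G r.output →
      IsEmpty (OfYield G r.output w) := by
    rintro r hr rfl hn
    exact ⟨fun p => hn (allUseful_output hr hA p.1)⟩
  have hfin : ∀ r : {r : ContextFreeRule T G.NT // r ∈ G.rules ∧ r.input = A},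
      Finite (OfYield G r.1.output w) := by
    intro r
    by_cases h : AllUseful G r.1.output
    · exact finite_ofYield hG h w
    · have := hempty r.1 r.2.1 r.2.2 h
      infer_instance
  let _ : Fintype {r : ContextFreeRule T G.NT // r ∈ G.rules ∧ r.input = A} :=
    Fintype.subtype (G.rules.filter fun r => r.input = A) (by simp)
  rw [count, Nat.card_congr (ofYieldNodeEquiv A w), Nat.card_sigma, Nat.cast_sum]
  change ∑ r : {r : ContextFreeRule T G.NT // r ∈ G.rules ∧ r.input = A},
    count G r.1.output w = _
  rw [← Finset.sum_subtype (G.rules.filter fun r => r.input = A) (by simp)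
    (fun r => count G r.output w)]
  symm
  refine Finset.sum_subset (fun r hr => ?_) fun r hr hn => ?_
  · rw [mem_usefulRules] at hr
    simp [hr.1, hr.2.1]
  · rw [Finset.mem_filter] at hr
    have := hempty r hr.1 hr.2 fun h => hn (mem_usefulRules.2 ⟨hr.1, hr.2, h⟩)
    simp [count]

/-- The univariate series counting the forests with yield in `c^*`. -/
noncomputable def uniSeries (G : ContextFreeGrammar T) (c : T) (s : List (Symbol T G.NT)) :
    PowerSeries (ZMod 2) :=
  PowerSeries.mk fun n => count G s (List.replicate n c)

/-- The bivariate series counting the forests with yield `a^n b^m`. -/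
noncomputable def biSeries (G : ContextFreeGrammar T) (a b : T) (s : List (Symbol T G.NT)) :
    MvPowerSeries (Fin 2) (ZMod 2) :=
  fun e => count G s (List.replicate (e 0) a ++ List.replicate (e 1) b)

theorem coeff_biSeries (a b : T) (s : List (Symbol T G.NT)) (e : Fin 2 →₀ ℕ) :
    MvPowerSeries.coeff e (biSeries G a b s) =
      count G s (List.replicate (e 0) a ++ List.replicate (e 1) b) :=
  rfl

theorem uniSeries_nil (c : T) : uniSeries G c [] = 1 := by
  classical
  ext n
  simp [uniSeries, count_nil, PowerSeries.coeff_one]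

theorem uniSeries_cons (hG : WellFormed G) (c : T) {X : Symbol T G.NT} {s : List (Symbol T G.NT)}
    (hs : AllUseful G (X :: s)) :
    uniSeries G c (X :: s) = uniSeries G c [X] * uniSeries G c s := by
  ext n
  rw [PowerSeries.coeff_mul, Finset.Nat.sum_antidiagonal_eq_sum_range_succ
    (fun i j => PowerSeries.coeff i (uniSeries G c [X]) * PowerSeries.coeff j (uniSeries G c s))]
  simp only [uniSeries, PowerSeries.coeff_mk, count_cons hG hs, List.length_replicate,
    List.take_replicate, List.drop_replicate]
  refine Finset.sum_congr rfl fun k hk => ?_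
  rw [min_eq_left (Nat.le_of_lt_succ (Finset.mem_range.1 hk))]

theorem uniSeries_eq_prod (hG : WellFormed G) (c : T) {s : List (Symbol T G.NT)}
    (hs : AllUseful G s) :
    uniSeries G c s = (s.map fun X => uniSeries G c [X]).prod := by
  induction s with
  | nil => exact uniSeries_nil c
  | cons X s ih => rw [uniSeries_cons hG c hs, ih hs.tail, List.map_cons, List.prod_cons]

theorem uniSeries_nonterminal (hG : WellFormed G) (c : T) {A : G.NT} (hA : Useful G A) :
    uniSeries G c [Symbol.nonterminal A] = ∑ r ∈ usefulRules G A, uniSeries G c r.output := by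
  ext n
  simp [uniSeries, count_nonterminal hG hA]

theorem uniSeries_terminal (c t : T) [Decidable (t = c)] :
    uniSeries G c [Symbol.terminal t] = if t = c then PowerSeries.X else 0 := by
  classical
  ext n
  have h : List.replicate n c = [t] ↔ t = c ∧ n = 1 := by
    rw [← List.replicate_one, List.replicate_inj]
    constructor
    · rintro ⟨rfl, h⟩
      exact ⟨(h.resolve_left one_ne_zero).symm, rfl⟩
    · rintro ⟨rfl, rfl⟩
      simp
  rw [uniSeries, PowerSeries.coeff_mk, count_terminal, if_congr h rfl rfl]
  by_cases htc : t = c <;> simp [htc, PowerSeries.coeff_X]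

theorem constantCoeff_uniSeries (c : T) (s : List (Symbol T G.NT)) :
    PowerSeries.constantCoeff (uniSeries G c s) = count G s [] := by
  simp [uniSeries, ← PowerSeries.coeff_zero_eq_constantCoeff_apply]

theorem coeff_inVar (i : Fin 2) (f : PowerSeries (ZMod 2)) (e : Fin 2 →₀ ℕ) :
    MvPowerSeries.coeff e (inVar i f) =
      if e = Finsupp.single i (e i) then PowerSeries.coeff (e i) f else 0 := by
  split_ifs with h
  · let ι : Unit ↪ Fin 2 := ⟨fun _ => i, fun _ _ _ => rfl⟩
    have := MvPowerSeries.coeff_embDomain_rename ι f (Finsupp.single () (e i))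
    rw [Finsupp.embDomain_single] at this
    rw [h, Finsupp.single_eq_same]
    exact this
  · refine MvPowerSeries.coeff_rename_eq_zero _ f ?_
    rintro ⟨g, rfl⟩
    apply h
    rw [show g = Finsupp.single () (g ()) from Finsupp.unique_single g, Finsupp.mapDomain_single]
    simp

theorem coeff_inVar_mul (i : Fin 2) (f : PowerSeries (ZMod 2)) (g : MvPowerSeries (Fin 2) (ZMod 2))
    (e : Fin 2 →₀ ℕ) :
    MvPowerSeries.coeff e (inVar i f * g) = ∑ k ∈ Finset.range (e i + 1),
      PowerSeries.coeff k f * MvPowerSeries.coeff (e - Finsupp.single i k) g := by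
  classical
  rw [MvPowerSeries.coeff_mul]
  symm
  refine Finset.sum_of_injOn (fun k => (Finsupp.single i k, e - Finsupp.single i k)) ?_ ?_ ?_ ?_
  · intro k _ l _ h
    exact Finsupp.single_injective i (congrArg Prod.fst h)
  · intro k hk
    rw [Finset.mem_coe, Finset.HasAntidiagonal.mem_antidiagonal]
    refine add_tsub_cancel_of_le (Finsupp.single_le_iff.2 ?_)
    exact Nat.le_of_lt_succ (by simpa using hk)
  · rintro ⟨p, q⟩ hp hn
    rw [Finset.HasAntidiagonal.mem_antidiagonal] at hp
    rw [coeff_inVar, if_neg, zero_mul]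
    intro h
    dsimp only at h hp
    refine hn ⟨p i, ?_, ?_⟩
    · simp [← hp]
    · simp only [← h, ← hp, add_tsub_cancel_left]
  · intro k _
    simp [coeff_inVar]

theorem constantCoeff_inVar (i : Fin 2) (f : PowerSeries (ZMod 2)) :
    MvPowerSeries.constantCoeff (inVar i f) = PowerSeries.constantCoeff f :=
  MvPowerSeries.constantCoeff_rename _ f

theorem coeff_inVar_zero_mul_inVar_one (f g : PowerSeries (ZMod 2)) (e : Fin 2 →₀ ℕ) :
    MvPowerSeries.coeff e (inVar 0 f * inVar 1 g) =
      PowerSeries.coeff (e 0) f * PowerSeries.coeff (e 1) g := by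
  rw [coeff_inVar_mul, Finset.sum_eq_single (e 0)]
  · rw [coeff_inVar, if_pos]
    · simp
    · ext j
      fin_cases j <;> simp
  · intro k hk hne
    rw [coeff_inVar, if_neg, mul_zero]
    intro h
    have h0 := DFunLike.congr_fun h 0
    simp at h0 hk
    omega
  · simp

theorem biSeries_nil (a b : T) : biSeries G a b [] = 1 := by
  classical
  ext e
  rw [coeff_biSeries, count_nil, MvPowerSeries.coeff_one]
  congr 1
  rw [Finsupp.ext_iff]
  simp

/-- A prefix of `a^n b^m` is a power of `a`, or the whole `a^n` followed by a power of `b`. -/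
theorem biSeries_cons (hG : WellFormed G) (a b : T) {X : Symbol T G.NT}
    {s : List (Symbol T G.NT)} (hs : AllUseful G (X :: s)) :
    biSeries G a b (X :: s) = inVar 0 (uniSeries G a [X]) * biSeries G a b s +
      (biSeries G a b [X] - inVar 0 (uniSeries G a [X])) * inVar 1 (uniSeries G b s) := by
  ext e
  rw [sub_mul, mul_comm (biSeries G a b [X]), map_add, map_sub, coeff_inVar_zero_mul_inVar_one,
    coeff_inVar_mul, coeff_inVar_mul, coeff_biSeries, count_cons hG hs]
  simp only [coeff_biSeries, uniSeries, PowerSeries.coeff_mk, List.length_append,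
    List.length_replicate]
  -- The splittings are cut at position `e 0`. The later ones are reflected, so that the index
  -- counts the letters `b` left for `s`. Both products on the right contain the splitting exactly
  -- at `e 0`; the subtracted term removes the duplicate.
  rw [add_assoc, Finset.sum_range_add, Finset.sum_range_succ _ (e 0),
    ← Finset.sum_range_reflect _ (e 1 + 1)]
  have h1 : ∀ k ∈ Finset.range (e 0),
      count G [X] ((List.replicate (e 0) a ++ List.replicate (e 1) b).take k) *
        count G s ((List.replicate (e 0) a ++ List.replicate (e 1) b).drop k) =
      count G [X] (List.replicate k a) * count G s
        (List.replicate ((e - Finsupp.single 0 k : Fin 2 →₀ ℕ) 0) a ++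
          List.replicate ((e - Finsupp.single 0 k : Fin 2 →₀ ℕ) 1) b) := by
    intro k hk
    have hk := (Finset.mem_range.1 hk).le
    simp [List.take_append, List.drop_append, Nat.sub_eq_zero_of_le hk, hk]
  have h2 : ∀ k ∈ Finset.range (e 1 + 1),
      count G [X] ((List.replicate (e 0) a ++ List.replicate (e 1) b).take
        (e 0 + (e 1 + 1 - 1 - k))) *
        count G s ((List.replicate (e 0) a ++ List.replicate (e 1) b).drop
          (e 0 + (e 1 + 1 - 1 - k))) =
      count G s (List.replicate k b) * count G [X]
        (List.replicate ((e - Finsupp.single 1 k : Fin 2 →₀ ℕ) 0) a ++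
          List.replicate ((e - Finsupp.single 1 k : Fin 2 →₀ ℕ) 1) b) := by
    intro k hk
    have hk := Nat.le_of_lt_succ (Finset.mem_range.1 hk)
    rw [mul_comm]
    simp [List.take_append, List.drop_append, Nat.sub_sub_self hk]
  rw [Finset.sum_congr rfl h1, Finset.sum_congr rfl h2]
  simp

end GF2

/-! ### The matrix of the linear system and its determinant -/

namespace GF2

open ParseForest

variable {T : Type*} {G : ContextFreeGrammar T}

section LinearForm

variable {N R R' : Type*} [CommRing R] [CommRing R']

open scoped Classical in
/-- The sum over all occurrences of the nonterminal `B` in a string of symbols, where the symbols to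
the left of the occurrence are weighted by `α` and the symbols to the right by `β`. -/
noncomputable def occurrenceSum (α β : Symbol T N → R) (B : N) : List (Symbol T N) → R
  | [] => 0
  | X :: s => (if X = Symbol.nonterminal B then (s.map β).prod else 0) +
      α X * occurrenceSum α β B s

theorem map_occurrenceSum (φ : R →+* R') (α β : Symbol T N → R) (B : N) (s : List (Symbol T N)) :
    φ (occurrenceSum α β B s) = occurrenceSum (φ ∘ α) (φ ∘ β) B s := by
  induction s with
  | nil => simp [occurrenceSum]
  | cons X s ih =>
    simp only [occurrenceSum, map_add, map_mul, ih, apply_ite φ, map_zero, map_list_prod,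
      List.map_map, Function.comp_apply]

/-- The part of the series of a string of symbols that is independent of the series of the
nonterminals; `δ` gives the series of the terminals. -/
def constantPart (α β : Symbol T N → R) (δ : T → R) : List (Symbol T N) → R
  | [] => 1
  | X :: s => ((match X with
      | .terminal t => δ t
      | .nonterminal _ => 0) - α X) * (s.map β).prod + α X * constantPart α β δ s

theorem occurrenceSum_mem {S : Type*} [SetLike S R] [SubringClass S R] (C : S)
    {α β : Symbol T N → R} {s : List (Symbol T N)} (hα : ∀ X ∈ s, α X ∈ C)
    (hβ : ∀ X ∈ s, β X ∈ C) (B : N) : occurrenceSum α β B s ∈ C := by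
  induction s with
  | nil => exact zero_mem C
  | cons X s ih =>
    rw [List.forall_mem_cons] at hα hβ
    refine add_mem ?_ (mul_mem hα.1 (ih hα.2 hβ.2))
    split_ifs
    · exact list_prod_mem (by simpa using hβ.2)
    · exact zero_mem C

theorem constantPart_mem {S : Type*} [SetLike S R] [SubringClass S R] (C : S)
    {α β : Symbol T N → R} {δ : T → R} {s : List (Symbol T N)} (hα : ∀ X ∈ s, α X ∈ C)
    (hβ : ∀ X ∈ s, β X ∈ C) (hδ : ∀ t, δ t ∈ C) : constantPart α β δ s ∈ C := by
  induction s with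
  | nil => exact one_mem C
  | cons X s ih =>
    rw [List.forall_mem_cons] at hα hβ
    refine add_mem (mul_mem (sub_mem ?_ hα.1) ?_) (mul_mem hα.1 (ih hα.2 hβ.2))
    · cases X with
      | terminal t => exact hδ t
      | nonterminal _ => exact zero_mem C
    · exact list_prod_mem (by simpa using hβ.2)

end LinearForm

/-- The parity of the number of parse trees of the empty string. -/
noncomputable def emptyCount (G : ContextFreeGrammar T) (X : Symbol T G.NT) : ZMod 2 :=
  count G [X] []

theorem exists_yield_nil_of_prod_ne_zero {s : List (Symbol T G.NT)}
    (h : (s.map (emptyCount G)).prod ≠ 0) : ∃ p : ParseForest G s, p.yield = [] := by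
  induction s with
  | nil => exact ⟨.nil, rfl⟩
  | cons X s ih =>
    rw [List.map_cons, List.prod_cons] at h
    obtain ⟨⟨p, hp⟩⟩ := nonempty_ofYield_of_count_ne_zero (left_ne_zero_of_mul h)
    obtain ⟨q, hq⟩ := ih (right_ne_zero_of_mul h)
    exact ⟨(consEquiv X s).symm (p, q), by rw [yield_consEquiv_symm, hp, hq]; rfl⟩

/-- A nonzero sum has a nonzero term: an occurrence of `B` all of whose siblings have trees with
empty yield. -/
theorem exists_context_of_occurrenceSum_ne_zero {B : G.NT} {s : List (Symbol T G.NT)}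
    (h : occurrenceSum (emptyCount G) (emptyCount G) B s ≠ 0) :
    ∃ f : ParseForest G [Symbol.nonterminal B] → ParseForest G s,
      ∀ t, (f t).yield = t.yield ∧ t.size ≤ (f t).size := by
  induction s with
  | nil => exact absurd rfl h
  | cons X s ih =>
    rw [occurrenceSum] at h
    classical
    by_cases h1 : emptyCount G X * occurrenceSum (emptyCount G) (emptyCount G) B s = 0
    · rw [h1, add_zero] at h
      obtain ⟨rfl, h2⟩ := (ite_ne_right_iff (b := (0 : ZMod 2))).1 h
      obtain ⟨q, hq⟩ := exists_yield_nil_of_prod_ne_zero h2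
      refine ⟨fun t => (consEquiv _ s).symm (t, q), fun t => ?_⟩
      simp [yield_consEquiv_symm, size_consEquiv_symm, hq]
    · obtain ⟨⟨p, hp⟩⟩ := nonempty_ofYield_of_count_ne_zero (left_ne_zero_of_mul h1)
      obtain ⟨f, hf⟩ := ih (right_ne_zero_of_mul h1)
      refine ⟨fun t => (consEquiv _ s).symm (p, f t), fun t => ?_⟩
      rw [yield_consEquiv_symm, size_consEquiv_symm, hp, (hf t).1]
      exact ⟨rfl, (hf t).2.trans (Nat.le_add_left _ _)⟩

/-- The useful nonterminals. -/
abbrev UsefulNT (G : ContextFreeGrammar T) : Type := {A : G.NT // Useful G A}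

noncomputable instance : Fintype (UsefulNT G) :=
  have := finite_useful G
  Fintype.ofFinite _

noncomputable instance : DecidableEq (UsefulNT G) := Classical.decEq _

/-- The matrix of the linear system for the series of the useful nonterminals. -/
noncomputable def systemMatrix {R : Type*} [CommRing R] (G : ContextFreeGrammar T)
    (α β : Symbol T G.NT → R) : Matrix (UsefulNT G) (UsefulNT G) R :=
  Matrix.of fun A B => ∑ r ∈ usefulRules G A.1, occurrenceSum α β B.1 r.output

/-- The root node of the rule makes the increase in size strict. -/
theorem enlarges_of_systemMatrix_ne_zero {A B : UsefulNT G}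
    (h : systemMatrix G (emptyCount G) (emptyCount G) A B ≠ 0) : Enlarges G A.1 B.1 := by
  obtain ⟨r, hr', h⟩ := Finset.exists_ne_zero_of_sum_ne_zero h
  obtain ⟨f, hf⟩ := exists_context_of_occurrenceSum_ne_zero h
  obtain ⟨hr, hA, -⟩ := mem_usefulRules.1 hr'
  clear hr' h
  obtain ⟨A, hA'⟩ := A
  dsimp only at hA
  subst hA
  refine ⟨fun t => .node r hr (f t) .nil, fun t => ?_⟩
  simp only [yield, size, List.append_nil, (hf t).1, true_and]
  have := (hf t).2
  omega

/-- On the finite set of useful nonterminals `Enlarges` is a strict order, and matrix entries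
outside it vanish. So a kernel vector vanishes by well-founded induction: each coordinate is a
combination of coordinates lower in this order. -/
theorem det_one_sub_systemMatrix_emptyCount_ne_zero (hG : WellFormed G) :
    (1 - systemMatrix G (emptyCount G) (emptyCount G)).det ≠ 0 := by
  rw [Ne, ← Matrix.exists_mulVec_eq_zero_iff]
  rintro ⟨v, hv, h⟩
  apply hv
  let r : UsefulNT G → UsefulNT G → Prop := fun B A => Enlarges G A.1 B.1
  have : IsTrans (UsefulNT G) r := ⟨fun _ _ _ h1 h2 => Enlarges.trans h2 h1⟩
  have : Std.Irrefl r := ⟨fun A => A.2.not_enlarges_self hG⟩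
  have hwf : WellFounded r := Finite.wellFounded_of_trans_of_irrefl r
  funext A
  induction A using hwf.induction with
  | _ A ih =>
    have hA := congrFun h A
    rw [Matrix.sub_mulVec, Matrix.one_mulVec, Pi.sub_apply, Pi.zero_apply, sub_eq_zero] at hA
    rw [hA, Pi.zero_apply]
    refine Finset.sum_eq_zero fun B _ => ?_
    change systemMatrix G (emptyCount G) (emptyCount G) A B * v B = 0
    by_cases hB : systemMatrix G (emptyCount G) (emptyCount G) A B = 0
    · rw [hB, zero_mul]
    · rw [ih B (enlarges_of_systemMatrix_ne_zero hB), Pi.zero_apply, mul_zero]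

/-- The determinant of the linear system is nonzero, because no useful nonterminal can be pumped
with the empty string. -/
theorem det_one_sub_systemMatrix_ne_zero {R : Type*} [CommRing R] (hG : WellFormed G)
    (φ : R →+* ZMod 2) {α β : Symbol T G.NT → R} (hα : ∀ X, φ (α X) = emptyCount G X)
    (hβ : ∀ X, φ (β X) = emptyCount G X) : (1 - systemMatrix G α β).det ≠ 0 := by
  intro h
  apply det_one_sub_systemMatrix_emptyCount_ne_zero hG
  have hα' : φ ∘ α = emptyCount G := funext hα
  have hβ' : φ ∘ β = emptyCount G := funext hβ
  rw [← map_zero φ, ← h, RingHom.map_det]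
  congr 1
  ext A B
  simp only [RingHom.mapMatrix_apply, Matrix.map_apply, Matrix.sub_apply, map_sub, systemMatrix,
    Matrix.of_apply, map_sum, map_occurrenceSum, hα', hβ', Matrix.one_apply, map_one]

/-! ### Algebraicity of the univariate series -/

section Univariate

open scoped Classical in
/-- The polynomial unknowns that stand for the univariate series of the symbols. -/
noncomputable def unknown (G : ContextFreeGrammar T) (c : T) :
    Symbol T G.NT → MvPolynomial (UsefulNT G) (Polynomial (ZMod 2))
  | .terminal t => MvPolynomial.C (if t = c then Polynomial.X else 0)
  | .nonterminal A => if h : Useful G A then MvPolynomial.X ⟨A, h⟩ else 0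

theorem aeval_unknown (c : T) {X : Symbol T G.NT} (hX : AllUseful G [X]) :
    MvPolynomial.aeval (fun A : UsefulNT G => uniSeries G c [Symbol.nonterminal A.1])
      (unknown G c X) = uniSeries G c [X] := by
  classical
  cases X with
  | terminal t =>
    rw [unknown, uniSeries_terminal, MvPolynomial.aeval_C, PowerSeries.algebraMap_apply']
    split_ifs <;> simp
  | nonterminal A =>
    rw [unknown, dif_pos (hX A (by simp)), MvPolynomial.aeval_X]

theorem aeval_prod_unknown (hG : WellFormed G) (c : T) {s : List (Symbol T G.NT)}
    (hs : AllUseful G s) :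
    MvPolynomial.aeval (fun A : UsefulNT G => uniSeries G c [Symbol.nonterminal A.1])
      (s.map (unknown G c)).prod = uniSeries G c s := by
  induction s with
  | nil => simp [uniSeries_nil]
  | cons X s ih =>
    rw [List.map_cons, List.prod_cons, map_mul, ih hs.tail, aeval_unknown c hs.head,
      ← uniSeries_cons hG c hs]

theorem pderiv_unknown (c : T) (B : UsefulNT G) (X : Symbol T G.NT)
    [Decidable (X = Symbol.nonterminal B.1)] :
    MvPolynomial.pderiv B (unknown G c X) = if X = Symbol.nonterminal B.1 then 1 else 0 := by
  classical
  cases X with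
  | terminal t => simp [unknown]
  | nonterminal A =>
    rw [unknown]
    split_ifs with h1 h2 h2
    · obtain rfl : A = B.1 := by simpa using h2
      exact MvPolynomial.pderiv_X_self _
    · refine MvPolynomial.pderiv_X_of_ne fun h => h2 ?_
      rw [← h]
    · obtain rfl : A = B.1 := by simpa using h2
      exact absurd B.2 h1
    · exact map_zero _

/-- With equal weights on both sides, `occurrenceSum` is the Leibniz rule for a product; this
identifies the Jacobian with `1 - systemMatrix`. -/
theorem aeval_pderiv_prod_unknown (hG : WellFormed G) (c : T) (B : UsefulNT G)
    {s : List (Symbol T G.NT)} (hs : AllUseful G s) :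
    MvPolynomial.aeval (fun A : UsefulNT G => uniSeries G c [Symbol.nonterminal A.1])
      (MvPolynomial.pderiv B (s.map (unknown G c)).prod) =
    occurrenceSum (fun X => uniSeries G c [X]) (fun X => uniSeries G c [X]) B.1 s := by
  classical
  induction s with
  | nil => simp [occurrenceSum]
  | cons X s ih =>
    rw [List.map_cons, List.prod_cons, Derivation.leibniz, occurrenceSum, ← ih hs.tail,
      ← aeval_unknown c hs.head, ← uniSeries_eq_prod hG c hs.tail,
      ← aeval_prod_unknown hG c hs.tail, pderiv_unknown]
    split_ifs <;> simp [add_comm]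

theorem isAlgebraic_uniSeries_of_useful (hG : WellFormed G) (c : T) (A : UsefulNT G) :
    IsAlgebraic (Polynomial (ZMod 2)) (uniSeries G c [Symbol.nonterminal A.1]) := by
  have : FaithfulSMul (Polynomial (ZMod 2)) (PowerSeries (ZMod 2)) := by
    rw [faithfulSMul_iff_algebraMap_injective]
    intro p q h
    simpa [PowerSeries.algebraMap_apply'] using h
  refine isAlgebraic_of_det_pderiv_ne_zero
    (α := fun A : UsefulNT G => uniSeries G c [Symbol.nonterminal A.1])
    (P := fun A => MvPolynomial.X A -
      ∑ r ∈ usefulRules G A.1, (r.output.map (unknown G c)).prod) (fun A => ?_) ?_ A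
  · rw [map_sub, MvPolynomial.aeval_X, map_sum, sub_eq_zero, uniSeries_nonterminal hG c A.2]
    refine Finset.sum_congr rfl fun r hr => ?_
    exact (aeval_prod_unknown hG c (mem_usefulRules.1 hr).2.2).symm
  · convert det_one_sub_systemMatrix_ne_zero hG PowerSeries.constantCoeff
      (α := fun X => uniSeries G c [X]) (β := fun X => uniSeries G c [X])
      (fun X => constantCoeff_uniSeries c [X]) (fun X => constantCoeff_uniSeries c [X]) using 2
    ext1 A B
    simp only [Matrix.of_apply, Matrix.sub_apply, systemMatrix, map_sub, map_sum,
      MvPolynomial.pderiv_X]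
    congr 1
    · rw [Matrix.one_apply, Pi.single_apply]
      split_ifs <;> simp_all
    · refine Finset.sum_congr rfl fun r hr => ?_
      exact aeval_pderiv_prod_unknown hG c B (mem_usefulRules.1 hr).2.2

end Univariate

end GF2

/-! ### The ring generated by `𝒜` and `ℬ`, and its denominators -/

namespace GF2

open ParseForest

variable {T : Type*} {G : ContextFreeGrammar T}

/-- The substitution of the variable number `i` into univariate series, as a homomorphism. -/
noncomputable def inVarHom (i : Fin 2) :
    PowerSeries (ZMod 2) →+* MvPowerSeries (Fin 2) (ZMod 2) :=
  (MvPowerSeries.rename (R := ZMod 2) (fun _ : Unit => i)).toRingHom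

theorem inVarHom_apply (i : Fin 2) (f : PowerSeries (ZMod 2)) : inVarHom i f = inVar i f :=
  rfl

theorem inVar_C (i : Fin 2) (r : ZMod 2) : inVar i (PowerSeries.C r) = MvPowerSeries.C r :=
  MvPowerSeries.rename_C _ r

theorem inVar_X (i : Fin 2) : inVar i PowerSeries.X = MvPowerSeries.X i :=
  MvPowerSeries.rename_X _ _

/-- `algSeries i` as a subalgebra. -/
noncomputable def algSubalgebra (i : Fin 2) :
    Subalgebra (ZMod 2) (MvPowerSeries (Fin 2) (ZMod 2)) where
  toSubsemiring := ((Subalgebra.algebraicClosure (Polynomial (ZMod 2))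
    (PowerSeries (ZMod 2))).toSubring.map (inVarHom i)).toSubsemiring
  algebraMap_mem' r := ⟨PowerSeries.C r, by
    have := isAlgebraic_algebraMap (R := Polynomial (ZMod 2)) (A := PowerSeries (ZMod 2))
      (Polynomial.C r)
    rw [PowerSeries.algebraMap_apply'] at this
    exact (Subalgebra.mem_algebraicClosure _ _).2 (by simpa using this), inVar_C i r⟩

theorem mem_algSubalgebra {i : Fin 2} {g : MvPowerSeries (Fin 2) (ZMod 2)} :
    g ∈ algSubalgebra i ↔ g ∈ algSeries i := by
  constructor
  · rintro ⟨f, hf, rfl⟩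
    exact ⟨f, hf, rfl⟩
  · rintro ⟨f, hf, rfl⟩
    exact ⟨f, hf, rfl⟩

theorem X_mem_algSubalgebra (i : Fin 2) : MvPowerSeries.X i ∈ algSubalgebra i := by
  rw [mem_algSubalgebra, ← inVar_X]
  refine ⟨_, ?_, rfl⟩
  have := isAlgebraic_algebraMap (R := Polynomial (ZMod 2)) (A := PowerSeries (ZMod 2))
    Polynomial.X
  rw [PowerSeries.algebraMap_apply'] at this
  simpa using this

/-- The series of the form `A₁ B₁ + ⋯ + Aₙ Bₙ` with `Aᵢ ∈ 𝒜` and `Bᵢ ∈ ℬ`. -/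
noncomputable def sumProd : Subalgebra (ZMod 2) (MvPowerSeries (Fin 2) (ZMod 2)) :=
  algSubalgebra 0 ⊔ algSubalgebra 1

theorem exists_eq_sum_of_mem_sumProd {x : MvPowerSeries (Fin 2) (ZMod 2)} (hx : x ∈ sumProd) :
    ∃ (n : ℕ) (A B : Fin n → MvPowerSeries (Fin 2) (ZMod 2)),
      (∀ i, A i ∈ algSeries 0) ∧ (∀ i, B i ∈ algSeries 1) ∧ x = ∑ i, A i * B i := by
  have hx : x ∈ Subalgebra.toSubmodule (algSubalgebra 0) *
      Subalgebra.toSubmodule (algSubalgebra 1) := by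
    rw [Subalgebra.mul_toSubmodule]
    exact hx
  refine Submodule.mul_induction_on hx (fun f hf g hg => ?_) ?_
  · exact ⟨1, fun _ => f, fun _ => g, fun _ => mem_algSubalgebra.1 hf,
      fun _ => mem_algSubalgebra.1 hg, by simp⟩
  · rintro _ _ ⟨n, A, B, hA, hB, rfl⟩ ⟨m, A', B', hA', hB', rfl⟩
    refine ⟨n + m, Fin.append A A', Fin.append B B', fun i => ?_, fun i => ?_, ?_⟩
    · refine Fin.addCases (fun i => ?_) (fun i => ?_) i
      · simpa using hA i
      · simpa using hA' i
    · refine Fin.addCases (fun i => ?_) (fun i => ?_) i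
      · simpa using hB i
      · simpa using hB' i
    · simp [Fin.sum_univ_add]

theorem X_mem_sumProd (i : Fin 2) : MvPowerSeries.X i ∈ sumProd := by
  fin_cases i
  · exact le_sup_left (a := algSubalgebra 0) (X_mem_algSubalgebra 0)
  · exact le_sup_right (a := algSubalgebra 0) (X_mem_algSubalgebra 1)

theorem coe_mem_sumProd (p : MvPolynomial (Fin 2) (ZMod 2)) :
    (p : MvPowerSeries (Fin 2) (ZMod 2)) ∈ sumProd := by
  induction p using MvPolynomial.induction_on with
  | C r =>
    rw [MvPolynomial.coe_C]
    exact sumProd.algebraMap_mem r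
  | add p q hp hq =>
    rw [MvPolynomial.coe_add]
    exact add_mem hp hq
  | mul_X p i hp =>
    rw [MvPolynomial.coe_mul, MvPolynomial.coe_X]
    exact mul_mem hp (X_mem_sumProd i)

theorem algebraMap_eq_coe (p : MvPolynomial (Fin 2) (ZMod 2)) :
    algebraMap (MvPolynomial (Fin 2) (ZMod 2)) (MvPowerSeries (Fin 2) (ZMod 2)) p = p := by
  rw [MvPowerSeries.algebraMap_apply']
  simp

/-- The algebraic equation is transported along `𝔽₂[t] → 𝔽₂[a, b]`; injectivity of this map keeps
the equation nontrivial. -/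
theorem isAlgebraic_of_mem_algSubalgebra {i : Fin 2} {g : MvPowerSeries (Fin 2) (ZMod 2)}
    (hg : g ∈ algSubalgebra i) : IsAlgebraic (MvPolynomial (Fin 2) (ZMod 2)) g := by
  obtain ⟨f, hf, rfl⟩ := hg
  refine IsAlgebraic.ringHom_of_comp_eq
    ((Polynomial.aeval (R := ZMod 2) (MvPolynomial.X (R := ZMod 2) i)).toRingHom :
      Polynomial (ZMod 2) →+* MvPolynomial (Fin 2) (ZMod 2)) (inVarHom i) hf ?_ ?_
  · exact transcendental_iff_injective.1 (MvPolynomial.transcendental_X (ZMod 2) i)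
  · refine Polynomial.ringHom_ext (fun r => ?_) ?_ <;>
      simp only [RingHom.comp_apply, PowerSeries.algebraMap_apply', algebraMap_eq_coe]
    · simp [inVarHom_apply, inVar_C]
    · simp [inVarHom_apply, inVar_X]

theorem isAlgebraic_of_mem_sumProd {g : MvPowerSeries (Fin 2) (ZMod 2)} (hg : g ∈ sumProd) :
    IsAlgebraic (MvPolynomial (Fin 2) (ZMod 2)) g := by
  obtain ⟨n, A, B, hA, hB, rfl⟩ := exists_eq_sum_of_mem_sumProd hg
  refine (Subalgebra.algebraicClosure (MvPolynomial (Fin 2) (ZMod 2))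
    (MvPowerSeries (Fin 2) (ZMod 2))).sum_mem fun i _ => ?_
  exact Subalgebra.mul_mem _
    (isAlgebraic_of_mem_algSubalgebra (mem_algSubalgebra.2 (hA i)))
    (isAlgebraic_of_mem_algSubalgebra (mem_algSubalgebra.2 (hB i)))

/-- Division by a nonzero element of `sumProd` reduces to division by a polynomial. -/
theorem exists_mul_eq_coe {d : MvPowerSeries (Fin 2) (ZMod 2)} (hd : d ∈ sumProd) (h0 : d ≠ 0) :
    ∃ y ∈ sumProd, ∃ p : MvPolynomial (Fin 2) (ZMod 2), p ≠ 0 ∧ d * y = p := by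
  -- Algebraicity is used inside `sumProd`, viewed as an algebra over the polynomials, so that the
  -- cofactor `y` lies in `sumProd` too.
  let C : Subalgebra (MvPolynomial (Fin 2) (ZMod 2)) (MvPowerSeries (Fin 2) (ZMod 2)) :=
    { toSubsemiring := sumProd.toSubsemiring
      algebraMap_mem' := fun p => by
        rw [algebraMap_eq_coe]
        exact coe_mem_sumProd p }
  have halg : IsAlgebraic (MvPolynomial (Fin 2) (ZMod 2)) (⟨d, hd⟩ : C) :=
    Subalgebra.isAlgebraic_iff_isAlgebraic_val.2 (isAlgebraic_of_mem_sumProd hd)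
  obtain ⟨p, hp, ⟨y, hy⟩, hdvd⟩ := halg.exists_nonzero_dvd
    (mem_nonZeroDivisors_of_ne_zero fun h => h0 (congrArg Subtype.val h))
  refine ⟨y, hy, p, hp, ?_⟩
  rw [← algebraMap_eq_coe]
  exact (congrArg Subtype.val hdvd).symm

/-- With `d * y = p`, the quotient `x / d` becomes `x * y / p`. -/
theorem algebraMap_mem_Rab {f d x : MvPowerSeries (Fin 2) (ZMod 2)} (hd : d ∈ sumProd)
    (h0 : d ≠ 0) (hx : x ∈ sumProd) (h : d * f = x) :
    algebraMap (MvPowerSeries (Fin 2) (ZMod 2)) Laurent f ∈ Rab := by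
  obtain ⟨y, hy, p, hp, hdy⟩ := exists_mul_eq_coe hd h0
  obtain ⟨n, A, B, hA, hB, hAB⟩ := exists_eq_sum_of_mem_sumProd (mul_mem hx hy)
  refine ⟨n, A, B, p, hA, hB, hp, ?_⟩
  rw [eq_div_iff, ← map_mul, ← hAB, ← hdy, ← h]
  · congr 1
    ring
  · rw [Ne, FaithfulSMul.algebraMap_eq_zero_iff]
    simpa using hp

/-! ### The bivariate linear system and Cramer's rule -/

theorem isAlgebraic_uniSeries (hG : WellFormed G) (c : T) {X : Symbol T G.NT}
    (hX : AllUseful G [X]) : IsAlgebraic (Polynomial (ZMod 2)) (uniSeries G c [X]) := by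
  classical
  cases X with
  | terminal t =>
    have := isAlgebraic_algebraMap (R := Polynomial (ZMod 2)) (A := PowerSeries (ZMod 2))
      (if t = c then Polynomial.X else 0)
    rw [PowerSeries.algebraMap_apply'] at this
    rw [uniSeries_terminal]
    split_ifs at this ⊢ <;> simpa using this
  | nonterminal A => exact isAlgebraic_uniSeries_of_useful hG c ⟨A, hX A (by simp)⟩

theorem inVar_uniSeries_mem_sumProd (hG : WellFormed G) (i : Fin 2) (c : T) {X : Symbol T G.NT}
    (hX : AllUseful G [X]) : inVar i (uniSeries G c [X]) ∈ sumProd := by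
  have h : inVar i (uniSeries G c [X]) ∈ algSubalgebra i :=
    mem_algSubalgebra.2 ⟨_, isAlgebraic_uniSeries hG c hX, rfl⟩
  fin_cases i
  · exact le_sup_left (a := algSubalgebra 0) h
  · exact le_sup_right (a := algSubalgebra 0) h

theorem replicate_append_replicate_eq_singleton_iff {a b t : T} {n m : ℕ} :
    List.replicate n a ++ List.replicate m b = [t] ↔
      (n = 1 ∧ m = 0 ∧ t = a) ∨ (n = 0 ∧ m = 1 ∧ t = b) := by
  constructor
  · intro h
    have hl : n + m = 1 := by simpa using congrArg List.length h
    obtain ⟨rfl, rfl⟩ | ⟨rfl, rfl⟩ : n = 1 ∧ m = 0 ∨ n = 0 ∧ m = 1 := by omega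
    · exact .inl ⟨rfl, rfl, by simpa using h.symm⟩
    · exact .inr ⟨rfl, rfl, by simpa using h.symm⟩
  · rintro (⟨rfl, rfl, rfl⟩ | ⟨rfl, rfl, rfl⟩) <;> rfl

theorem biSeries_terminal_mem_sumProd {a b : T} (hab : a ≠ b) (t : T) :
    biSeries G a b [Symbol.terminal t] ∈ sumProd := by
  classical
  have h : biSeries G a b [Symbol.terminal t] =
      (if t = a then MvPowerSeries.X 0 else 0) + (if t = b then MvPowerSeries.X 1 else 0) := by
    ext e
    rw [coeff_biSeries, count_terminal, map_add, apply_ite (MvPowerSeries.coeff e),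
      apply_ite (MvPowerSeries.coeff e), MvPowerSeries.coeff_X, MvPowerSeries.coeff_X,
      map_zero (MvPowerSeries.coeff e),
      if_congr replicate_append_replicate_eq_singleton_iff rfl rfl]
    have h0 : e = Finsupp.single 0 1 ↔ e 0 = 1 ∧ e 1 = 0 := by simp [Finsupp.ext_iff]
    have h1 : e = Finsupp.single 1 1 ↔ e 0 = 0 ∧ e 1 = 1 := by simp [Finsupp.ext_iff]
    rw [if_congr h0 rfl rfl, if_congr h1 rfl rfl]
    by_cases ha : t = a
    · subst ha
      simp [hab]
    · simp [ha, ← ite_and, and_comm, and_left_comm]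
  rw [h]
  refine add_mem ?_ ?_ <;> split_ifs
  exacts [X_mem_sumProd 0, zero_mem _, X_mem_sumProd 1, zero_mem _]

/-- Unrolling `biSeries_cons`, each symbol `X` contributes its series minus its pure `a` part,
weighted by the `a`-series to the left and the `b`-series to the right; the product of all
`a`-series is left over. Only the series of nonterminals are treated as unknowns. -/
theorem biSeries_eq (hG : WellFormed G) (a b : T) {s : List (Symbol T G.NT)}
    (hs : AllUseful G s) :
    biSeries G a b s = ∑ B : UsefulNT G,
      occurrenceSum (fun X => inVar 0 (uniSeries G a [X])) (fun X => inVar 1 (uniSeries G b [X]))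
        B.1 s * biSeries G a b [Symbol.nonterminal B.1] +
      constantPart (fun X => inVar 0 (uniSeries G a [X])) (fun X => inVar 1 (uniSeries G b [X]))
        (fun t => biSeries G a b [Symbol.terminal t]) s := by
  induction s with
  | nil => simp [occurrenceSum, constantPart, biSeries_nil]
  | cons X s ih =>
    have hprod : inVar 1 (uniSeries G b s) =
        (s.map fun X => inVar 1 (uniSeries G b [X])).prod := by
      rw [uniSeries_eq_prod hG b hs.tail, ← inVarHom_apply, map_list_prod, List.map_map]
      rfl
    rw [biSeries_cons hG a b hs, hprod, ih hs.tail]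
    simp only [occurrenceSum, constantPart, add_mul, Finset.sum_add_distrib, mul_assoc,
      ← Finset.mul_sum]
    generalize (s.map fun X => inVar 1 (uniSeries G b [X])).prod = q
    classical
    cases X with
    | terminal t =>
      simp only [reduceCtorEq, if_false, zero_mul, Finset.sum_const_zero]
      ring
    | nonterminal A =>
      have hA : ∑ B : UsefulNT G,
          (if (Symbol.nonterminal A : Symbol T G.NT) = Symbol.nonterminal B.1 then q else 0) *
          biSeries G a b [Symbol.nonterminal B.1] = q * biSeries G a b [Symbol.nonterminal A] := by
        rw [Finset.sum_eq_single (⟨A, hs A (by simp)⟩ : UsefulNT G)]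
        · rw [if_pos rfl]
        · intro B _ hB
          rw [if_neg, zero_mul]
          intro h
          exact hB (Subtype.ext (by simpa using h.symm))
        · simp
      rw [hA]
      ring

theorem algebraMap_biSeries_mem_Rab (hG : WellFormed G) {a b : T} (hab : a ≠ b)
    (A : UsefulNT G) :
    algebraMap (MvPowerSeries (Fin 2) (ZMod 2)) Laurent
      (biSeries G a b [Symbol.nonterminal A.1]) ∈ Rab := by
  let α : Symbol T G.NT → MvPowerSeries (Fin 2) (ZMod 2) := fun X => inVar 0 (uniSeries G a [X])
  let β : Symbol T G.NT → MvPowerSeries (Fin 2) (ZMod 2) := fun X => inVar 1 (uniSeries G b [X])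
  let M := 1 - systemMatrix G α β
  let v : UsefulNT G → MvPowerSeries (Fin 2) (ZMod 2) :=
    fun A => biSeries G a b [Symbol.nonterminal A.1]
  let c : UsefulNT G → MvPowerSeries (Fin 2) (ZMod 2) := fun A => ∑ r ∈ usefulRules G A.1,
    constantPart α β (fun t => biSeries G a b [Symbol.terminal t]) r.output
  have huse : ∀ {A : UsefulNT G} {r : ContextFreeRule T G.NT}, r ∈ usefulRules G A.1 →
      ∀ X ∈ r.output, AllUseful G [X] := fun hr X hX B hB =>
    (mem_usefulRules.1 hr).2.2 B (by rw [List.mem_singleton] at hB; rwa [hB])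
  have hc : ∀ A, c A ∈ sumProd := fun A => sum_mem fun r hr => constantPart_mem sumProd
    (fun X hX => inVar_uniSeries_mem_sumProd hG 0 a (huse hr X hX))
    (fun X hX => inVar_uniSeries_mem_sumProd hG 1 b (huse hr X hX))
    (fun t => biSeries_terminal_mem_sumProd hab t)
  have hM : ∀ A B, M A B ∈ sumProd := fun A B => by
    have hAB : M A B = (1 : Matrix (UsefulNT G) (UsefulNT G) _) A B - systemMatrix G α β A B := rfl
    rw [hAB]
    refine sub_mem ?_ (sum_mem fun r hr => occurrenceSum_mem sumProd
      (fun X hX => inVar_uniSeries_mem_sumProd hG 0 a (huse hr X hX))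
      (fun X hX => inVar_uniSeries_mem_sumProd hG 1 b (huse hr X hX)) B.1)
    rw [Matrix.one_apply]
    split_ifs
    exacts [one_mem _, zero_mem _]
  have hsys : M.mulVec v = c := by
    rw [Matrix.sub_mulVec, Matrix.one_mulVec, sub_eq_iff_eq_add']
    funext A
    have hA : v A = ∑ r ∈ usefulRules G A.1, biSeries G a b r.output := by
      ext e
      simp only [v, map_sum, coeff_biSeries]
      exact count_nonterminal hG A.2 _
    rw [hA, Finset.sum_congr rfl fun r hr => biSeries_eq hG a b (mem_usefulRules.1 hr).2.2,
      Finset.sum_add_distrib, Finset.sum_comm]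
    simp only [← Finset.sum_mul]
    rfl
  -- The same matrix over the subring `sumProd`, which shows that its determinant and adjugate have
  -- entries there.
  let M' : Matrix (UsefulNT G) (UsefulNT G) sumProd := Matrix.of fun A B => ⟨M A B, hM A B⟩
  have hM' : M = sumProd.val.toRingHom.mapMatrix M' := rfl
  have hdet : M.det ∈ sumProd := by
    rw [hM', ← RingHom.map_det]
    exact (M'.det).2
  have hadj : ∀ A B, M.adjugate A B ∈ sumProd := fun A B => by
    rw [hM', ← RingHom.map_adjugate]
    exact (M'.adjugate A B).2
  -- Cramer's rule: multiplying `M v = c` by the adjugate gives `det M • v = adj M · c`.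
  refine algebraMap_mem_Rab hdet ?_ (x := (M.adjugate.mulVec c) A)
    (sum_mem fun B _ => mul_mem (hadj A B) (hc B)) ?_
  · refine det_one_sub_systemMatrix_ne_zero hG MvPowerSeries.constantCoeff (fun X => ?_)
      fun X => ?_ <;>
    · rw [constantCoeff_inVar, constantCoeff_uniSeries]
      rfl
  · rw [← hsys, Matrix.mulVec_mulVec, Matrix.adjugate_mul, Matrix.smul_mulVec, Matrix.one_mulVec]
    rfl

theorem dual_languageOf (G : ContextFreeGrammar T) (a b : T) (A : G.NT) :
    dual a b (languageOf G A) = biSeries G a b [Symbol.nonterminal A] := by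
  classical
  ext e
  have hmem : List.replicate (e 0) a ++ List.replicate (e 1) b ∈ languageOf G A ↔
      Odd (Nat.card (OfYield G [Symbol.nonterminal A]
        (List.replicate (e 0) a ++ List.replicate (e 1) b))) := by
    change Odd (Set.ncard _) ↔ _
    rw [← Nat.card_coe_set_eq]
    rfl
  rw [coeff_biSeries, count, MvPowerSeries.coeff_apply, dual, if_congr hmem rfl rfl]
  split_ifs with h
  · exact (ZMod.natCast_eq_one_iff_odd.2 h).symm
  · exact (ZMod.natCast_eq_zero_iff_even.2 (Nat.not_odd_iff_even.1 h)).symm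

end GF2

theorem theorem3p1 {T : Type*} (a b : T) (hab : a ≠ b) (K : Language T)
    (hK : K ≤ GF2.aStarBStar a b) (hG : GF2.IsDescribed K) :
    algebraMap (MvPowerSeries (Fin 2) (ZMod 2)) GF2.Laurent (GF2.dual a b K) ∈ GF2.Rab := by
  obtain ⟨G, hG, rfl⟩ := hG
  rw [GF2.dual_languageOf]
  by_cases h : Nonempty (GF2.ParseForest G [Symbol.nonterminal G.initial])
  · exact GF2.algebraMap_biSeries_mem_Rab hG hab ⟨G.initial, GF2.useful_initial h⟩
  -- Without any parse tree the initial symbol is not useful, but then the series is zero.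
  · have h0 : GF2.biSeries G a b [Symbol.nonterminal G.initial] = 0 := by
      ext e
      by_contra hne
      exact h ((GF2.nonempty_ofYield_of_count_ne_zero hne).map Subtype.val)
    rw [h0]
    exact GF2.algebraMap_mem_Rab (one_mem _) one_ne_zero (zero_mem _) (mul_zero 1)
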